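/- **Setting.** Computations with a stop-gradient operator $\bot$ in a parameter $\theta$ (a point of a real normed space) are modelled as functions $F(t,s)$ of a live input $t$ and a frozen input $s$: $(\bot F)(t,s)=F(s,s)$; forward-mode evaluation is $\overrightarrow{F}(t)=F(t,t)$; $\nabla^{(m)}F$ is the $m$-th derivative in $t$ only; $F$ is identical under evaluation if $\overrightarrow{\nabla^{(m)}F}=\nabla^{(m)}F$ for all $m$, i.e. if $F$ does not depend on $s$; and $\mathrm{magic}(L)=\exp(L-\bot L)$. A stochastic computation graph is a finite directed acyclic graph whose nodes are either stochastic, with a conditional probability density $p_S(x_S\mid x_{\mathrm{pa}(S)})$ with respect to a $\sigma$-finite reference measure, or deterministic, with a function $f_D$ of the parents' values; $\theta$ is a deterministic node without parents. Let $C$ be a real-valued deterministic node (for instance a cost node), and let $\mathcal S_1,\dots,\mathcal S_k$ be a topologically sorted partition of the stochastic nodes that influence $C$, with values $x_i$ of $\mathcal S_i$ and $x_{<i}$ of $\mathcal S_1,\dots,\mathcal S_{i-1}$. Let $\mathbb E[C]=\int\prod_S p_S(x_S\mid x_{\mathrm{pa}(S)})\,C(x)\,dx$, the product being over the stochastic nodes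 that influence $C$, and let $\mathbb E_{\mathcal S_i}[f(x_i)]$ be the expectation under the conditional density of $x_i$ given $x_{<i}$. For each $i$ let $\langle q_i,w_i,l_i,a_i\rangle$ be a gradient estimator: a proposal distribution $q_i(\mathcal X_i\mid x_{<i})$ of a finite sample $\mathcal X_i$ of values of $x_i$, a weighting function $w_i\ge 0$, a gradient function $l_i$ and a control variate $a_i$ (which may depend on $\theta$, $x_{<i}$, $x_i\in\mathcal X_i$ and $\mathcal X_i$). The surrogate loss is $$\mathrm{SL}=\sum_{x_1\in\mathcal X_1}w_1\Big[a_1+\sum_{x_2\in\mathcal X_2}w_2\Big[\mathrm{magic}(l_1)a_2+\dots+\sum_{x_k\in\mathcal X_k}w_k\Big[\mathrm{magic}\Big(\sum_{j<k}l_j\Big)a_k+\mathrm{magic}\Big(\sum_{j\le k}l_j\Big)C\Big]\dots\Big]\Big],$$ where $\mathcal X_i\sim q_i(\cdot\mid x_{<i})$ is drawn independently for each choice of $x_{<i}$. **Theorem 1.** Fix $n\ge0$ and a value $\theta_0$ of $\theta$. Assume that all functions $f_D$ and all densities $p_S$ are identical under evaluation. Assume the following regularity: the integral $\mathbb E[C]$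 converges absolutely for $\theta$ near $\theta_0$ and is $n$ times continuously differentiable at $\theta_0$; the functions $w_i,l_i,a_i$ are $n$ times continuously differentiable in the live input at $\theta_0$ (with frozen input $\theta_0$); and for each $i$ and $x_{<i}$ there is given a class $\mathcal F_i(x_{<i})$ of deterministic functions $f(x_i)$ of $x_i$ and $\theta$ that are $n$ times continuously differentiable in the same sense and that include the conditional expectation $x_i\mapsto\mathbb E_{\mathcal S_{i+1}}[\cdots\mathbb E_{\mathcal S_k}[C]\cdots]$ of $C$ given $x_{<i},x_i$. Assume that for all $i=1,\dots,k$, all $x_{<i}$ and all $0\le m\le n$ (everything evaluated at $\theta_0$, and all expectations under $q_i$ being assumed to exist): 1. $\mathbb E_{q_i}\big[\sum_{x_i\in\mathcal X_i}\overrightarrow{\nabla^{(m)}_\theta\, w_i\,\mathrm{magic}(l_i)\,f(x_i)}\big]=\overrightarrow{\nabla^{(m)}_\theta\,\mathbb E_{\mathcal S_i}[f(x_i)]}$ for every $f\in\mathcal F_i(x_{<i})$; 2. $\mathbb E_{q_i}\big[\sum_{x_i\in\mathcal X_i}\overrightarrow{\nabla^{(m)}_\theta\, w_i a_i}\big]=0$;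 3. $\mathbb E_{q_i}\big[\sum_{x_i\in\mathcal X_i}\overrightarrow{\nabla^{(m)}_\theta\, w_i}\big]=0$ if $m>0$; 4. $\overrightarrow{q_i}=q_i$. Then the evaluated $n$-th derivative of the surrogate loss is an unbiased estimate of $\nabla^{(n)}_\theta\mathbb E[C]$ at $\theta_0$: writing $W_i=\prod_{j\le i}w_j$ and $L_i=\sum_{j\le i}l_j$, $$\nabla_\theta^{(n)}\mathbb E[C]=\mathbb E_{q_1}\Big[\sum_{x_1\in\mathcal X_1}\overrightarrow{\nabla^{(n)}_\theta W_1a_1}+\dots+\mathbb E_{q_k}\Big[\sum_{x_k\in\mathcal X_k}\overrightarrow{\nabla^{(n)}_\theta W_k\,\mathrm{magic}(L_{k-1})\,a_k}+\overrightarrow{\nabla^{(n)}_\theta W_k\,\mathrm{magic}(L_k)\,C}\Big]\dots\Big],$$ and, if $\overrightarrow{\nabla^{(n)}_\theta\mathrm{SL}}$ is integrable under the joint law of all samples, also $\mathbb E\big[\overrightarrow{\nabla^{(n)}_\theta\mathrm{SL}}\big]=\nabla^{(n)}_\theta\mathbb E[C]$. -/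

import Mathlib

open MeasureTheory ProbabilityTheory
open scoped Topology

noncomputable section

/-! ### Computations with a stop-gradient operator

A quantity that an automatic differentiation library computes from an input in `E`, with possible
uses of stop-grad, is a function of two copies of the input: the first copy is *live*, i.e. seen by
differentiation, and the second one is *frozen*, i.e. it is what stop-grad reads. -/

/-- Computations with stop-gradients: the first argument is live, the second one is frozen. -/
abbrev ADFun (E β : Type) : Type := E → E → β

namespace ADFun

variable {E β : Type}

/-- The stop-grad operator: the whole argument reads the frozen input. -/
def stopGrad (F : ADFun E β) : ADFun E β := fun _ s => F s s

/-- Forward-mode evaluation: live and frozen input are the same actual input. -/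
def forward (F : ADFun E β) : E → β := fun t => F t t

/-- `F` is identical under evaluation: it equals its own forward-mode evaluation, whatever the
frozen input is. For differentiable-valued computations this is the same as the equality of all
derivatives with their forward-mode evaluations, see `identicalUnderEval_iff_grad`. -/
def IdenticalUnderEval (F : ADFun E β) : Prop := ∀ t s, F t s = F.forward t

/-- The magic box `exp (L - stopGrad L)`. -/
def magic (L : ADFun E ℝ) : ADFun E ℝ := fun t s => Real.exp (L t s - stopGrad L t s)

variable [NormedAddCommGroup E] [NormedSpace ℝ E]

/-- The `m`-th order derivative, which only sees the live input. -/
def grad (m : ℕ) (F : ADFun E ℝ) : ADFun E (E [×m]→L[ℝ] ℝ) :=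
  fun t s => iteratedFDeriv ℝ m (fun u => F u s) t

theorem identicalUnderEval_iff_grad (F : ADFun E ℝ) :
    F.IdenticalUnderEval ↔ ∀ m t s, F.grad m t s = (F.grad m).forward t := by
  constructor
  · intro h m t s
    have : (fun u => F u s) = fun u => F u t := by
      funext u
      rw [h u s, h u t]
    simp only [forward, grad, this]
  · intro h t s
    have h0 := congrArg (fun T => T (0 : Fin 0 → E)) (h 0 t s)
    simpa [forward, grad] using h0

/-- `F` is `n` times continuously differentiable in the live input at `t`, with frozen input `t`. -/
def SmoothAt (n : ℕ) (F : ADFun E ℝ) (t : E) : Prop := ContDiffAt ℝ n (fun u => F u t) t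

end ADFun

/-! ### Expectations -/

/-- The expectation of `g` under `q` exists and equals `c`. -/
def HasMean {Ω B : Type} [MeasurableSpace Ω] [NormedAddCommGroup B] [NormedSpace ℝ B]
    (q : Measure Ω) (g : Ω → B) (c : B) : Prop :=
  Integrable g q ∧ ∫ ω, g ω ∂q = c

/-- Finite samples (of arbitrary, possibly random size) of elements of `X`, repetitions allowed. -/
abbrev FinSample (X : Type) : Type := Σ m : ℕ, (Fin m → X)

/-- The sample with the `m` values `x 0, …, x (m - 1)`. -/
abbrev FinSample.mk {X : Type} (m : ℕ) (x : Fin m → X) : FinSample X := ⟨m, x⟩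

theorem FinSample.mk_injective {X : Type} {m : ℕ} : Function.Injective (FinSample.mk (X := X) m) :=
  fun x y h => by simpa using h

theorem measurableEmbedding_sizeMk (X : Type) [MeasurableSpace X] (m : ℕ) :
    MeasurableEmbedding (FinSample.mk (X := X) m) where
  injective := FinSample.mk_injective
  measurable := fun s hs => (MeasurableSpace.measurableSet_iInf.1 hs) m
  measurableSet_image' := by
    intro s hs
    refine MeasurableSpace.measurableSet_iInf.2 fun m' => ?_
    change MeasurableSet (FinSample.mk m' ⁻¹' (FinSample.mk m '' s))
    by_cases h : m = m'
    · subst h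
      rwa [Set.preimage_image_eq _ FinSample.mk_injective]
    · have : FinSample.mk m' ⁻¹' (FinSample.mk m '' s) = ∅ := by
        ext y
        simp only [Set.mem_preimage, Set.mem_image, Set.mem_empty_iff_false, iff_false]
        rintro ⟨z, -, hz⟩
        exact h (congrArg Sigma.fst hz)
      rw [this]
      exact MeasurableSet.empty

/-- A function on `H × FinSample X` is measurable if it is so for each sample size. -/
theorem measurable_of_sizes {H X Y : Type} [MeasurableSpace H] [MeasurableSpace X]
    [MeasurableSpace Y] {f : H × FinSample X → Y}
    (hf : ∀ m : ℕ, Measurable fun p : H × (Fin m → X) => f (p.1, ⟨m, p.2⟩)) : Measurable f := by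
  intro S hS
  have key : f ⁻¹' S = ⋃ m : ℕ, Prod.map (id : H → H) (FinSample.mk (X := X) m) ''
      ((fun p : H × (Fin m → X) => f (p.1, ⟨m, p.2⟩)) ⁻¹' S) := by
    ext ⟨h, m, x⟩
    simp only [Set.mem_preimage, Set.mem_iUnion, Set.mem_image, Prod.exists]
    constructor
    · intro hx
      exact ⟨m, h, x, hx, rfl⟩
    · rintro ⟨m', h', x', hx', he⟩
      have he' : ((h', ⟨m', x'⟩) : H × FinSample X) = (h, ⟨m, x⟩) := he
      rw [← he']
      exact hx'
  rw [key]
  exact MeasurableSet.iUnion fun m => ((MeasurableEmbedding.id.prodMap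
    (measurableEmbedding_sizeMk X m)).measurableSet_image).2 (hf m hS)

theorem measurable_pi_family {A ι Z : Type} [Fintype ι] [MeasurableSpace A] [MeasurableSpace Z]
    (μ : ι → A → Measure Z) [∀ i a, IsProbabilityMeasure (μ i a)] (hμ : ∀ i, Measurable (μ i)) :
    Measurable fun a => Measure.pi fun i => μ i a := by
  refine Measurable.measure_of_isPiSystem_of_isProbabilityMeasure generateFrom_pi.symm
    isPiSystem_pi ?_
  rintro _ ⟨s, hs, rfl⟩
  simp only [Measure.pi_pi]
  exact Finset.measurable_prod _ fun i _ =>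
    (Measure.measurable_coe (hs i (Set.mem_univ i))).comp (hμ i)

/-- Given a history and a finite sample, continue independently from each sampled value according
to `κ`; the outcome is the sample together with the continuation of each of its values. -/
def branch {H X Y : Type} [MeasurableSpace H] [MeasurableSpace X] [MeasurableSpace Y]
    (κ : Kernel (H × X) Y) [IsMarkovKernel κ] :
    Kernel (H × FinSample X) (FinSample (X × Y)) where
  toFun p := (Measure.pi fun j => (Measure.dirac (p.2.2 j)).prod (κ (p.1, p.2.2 j))).map
    (FinSample.mk p.2.1)
  measurable' := by
    refine measurable_of_sizes fun m => ?_
    refine (Measure.measurable_map _ (measurableEmbedding_sizeMk (X × Y) m).measurable).comp ?_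
    refine measurable_pi_family (fun (j : Fin m) (p : H × (Fin m → X)) =>
      (Measure.dirac (p.2 j)).prod (κ (p.1, p.2 j))) fun j => ?_
    have hj : Measurable fun p : H × (Fin m → X) => (p.1, p.2 j) :=
      measurable_fst.prodMk ((measurable_pi_apply j).comp measurable_snd)
    have := ((Kernel.deterministic (fun q : H × X => q.2) measurable_snd ×ₖ κ).measurable).comp hj
    simpa [Function.comp_def, Kernel.prod_apply, Kernel.deterministic_apply] using this

instance branch.instIsMarkovKernel {H X Y : Type} [MeasurableSpace H] [MeasurableSpace X]
    [MeasurableSpace Y] (κ : Kernel (H × X) Y) [IsMarkovKernel κ] : IsMarkovKernel (branch κ) :=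
  ⟨fun p => Measure.isProbabilityMeasure_map
    (measurableEmbedding_sizeMk (X × Y) p.2.1).measurable.aemeasurable⟩

/-! ### Stochastic computation graphs -/

/-- A stochastic computation graph: a finite directed acyclic graph with stochastic and
deterministic nodes. Each stochastic node carries a probability density (with respect to a
reference measure on its sample space) given the values of its parents, each deterministic node a
function of the values of its parents. Densities and functions may use stop-grad, so that they
depend on a live and on a frozen copy of the values of the parents. -/
structure SCG where
  Node : Type
  [fintypeNode : Fintype Node]
  /-- `edge u v`: there is an edge from `u` to `v`, i.e. `u` is a parent of `v`. -/
  edge : Node → Node → Prop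
  acyclic : ∀ v, ¬ Relation.TransGen edge v v
  /-- The stochastic nodes; all other nodes are deterministic. -/
  stoch : Set Node
  /-- The parameters. -/
  params : Set Node
  params_det : ∀ v ∈ params, v ∉ stoch
  params_root : ∀ v ∈ params, ∀ u, ¬ edge u v
  /-- The cost nodes. -/
  costs : Set Node
  costs_det : ∀ v ∈ costs, v ∉ stoch
  costs_sink : ∀ v ∈ costs, ∀ u, ¬ edge v u
  /-- The values a node can take; the sample space if the node is stochastic. -/
  Val : Node → Type
  costs_real : ∀ v ∈ costs, Val v = ℝ
  [measurableSpaceVal : ∀ v, MeasurableSpace (Val v)]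
  /-- The reference measures; only those of stochastic nodes are ever used. -/
  ref : ∀ v, Measure (Val v)
  [sigmaFinite_ref : ∀ v, SigmaFinite (ref v)]
  /-- The function of a deterministic node (the current value, if the node is a parameter). -/
  func : ∀ v, v ∉ stoch → ADFun (∀ u : {u // edge u v}, Val u) (Val v)
  /-- The density of a stochastic node given its parents. -/
  dens : ∀ v, v ∈ stoch → ADFun (∀ u : {u // edge u v}, Val u) (Val v → ℝ)
  dens_nonneg : ∀ v hv a y, 0 ≤ (dens v hv).forward a y
  dens_measurable : ∀ v hv a, Measurable ((dens v hv).forward a)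
  dens_prob : ∀ v hv a, ∫⁻ y, ENNReal.ofReal ((dens v hv).forward a y) ∂(ref v) = 1

namespace SCG

attribute [instance] SCG.fintypeNode SCG.measurableSpaceVal SCG.sigmaFinite_ref

variable (G : SCG)

/-- All functions of deterministic nodes and all densities of stochastic nodes are identical under
evaluation. -/
def IdenticalUnderEval : Prop :=
  (∀ v hv, (G.func v hv).IdenticalUnderEval) ∧ ∀ v hv, (G.dens v hv).IdenticalUnderEval

theorem edge_wf : WellFounded G.edge := by
  have : IsTrans G.Node (Relation.TransGen G.edge) := ⟨fun _ _ _ h k => h.trans k⟩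
  have : Std.Irrefl (Relation.TransGen G.edge) := ⟨G.acyclic⟩
  exact Subrelation.wf Relation.TransGen.single
    (Finite.wellFounded_of_trans_of_irrefl (Relation.TransGen G.edge))

/-- The stochastic nodes that influence `v`. -/
def stochBefore (v : G.Node) : Set G.Node := {s | s ∈ G.stoch ∧ Relation.TransGen G.edge s v}

/-- Assignments of values to the nodes in `A`. -/
abbrev Assign (A : Set G.Node) : Type := ∀ s : A, G.Val s

/-- The nodes of `A` determine the value of `v`: all stochastic nodes that influence `v`, and `v`
itself if it is stochastic, belong to `A`. -/
def Known (A : Set G.Node) (v : G.Node) : Prop :=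
  ∀ s ∈ G.stoch, Relation.ReflTransGen G.edge s v → s ∈ A

variable {G}

theorem Known.parent {A : Set G.Node} {v u : G.Node} (h : G.Known A v) (huv : G.edge u v) :
    G.Known A u := fun s hs hsu => h s hs (hsu.tail huv)

open scoped Classical in
/-- The value of node `v` as a computation in the parameter `θ`, given the values `x` of the
stochastic nodes in `A`. -/
def val (θ : G.Node) {A : Set G.Node} (x : G.Assign A) :
    ∀ v, G.Known A v → ADFun (G.Val θ) (G.Val v) :=
  G.edge_wf.fix fun v rec hv =>
    if h : θ = v then fun t _ => cast (congrArg G.Val h) t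
    else if hs : v ∈ G.stoch then fun _ _ => x ⟨v, hv v hs Relation.ReflTransGen.refl⟩
    else fun t s => G.func v hs (fun u => rec u u.2 (hv.parent u.2) t s)
      (fun u => rec u u.2 (hv.parent u.2) s s)

/-- The conditional density of the stochastic node `v` given its parents, at the values `x`, as a
computation in the parameter `θ`. -/
def nodeDens (θ : G.Node) {A : Set G.Node} (x : G.Assign A) (v : G.Node) (hv : v ∈ G.stoch)
    (hA : G.Known A v) : ADFun (G.Val θ) ℝ := fun t s =>
  G.dens v hv (fun u => val θ x u (hA.parent u.2) t s) (fun u => val θ x u (hA.parent u.2) s s)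
    (x ⟨v, hA v hv Relation.ReflTransGen.refl⟩)

variable (G) in
/-- A real-valued deterministic node. -/
structure RealNode where
  node : G.Node
  det : node ∉ G.stoch
  real : G.Val node = ℝ

/-- Each cost node is a real-valued deterministic node. -/
def RealNode.ofCost (c : G.Node) (hc : c ∈ G.costs) : G.RealNode :=
  ⟨c, G.costs_det c hc, G.costs_real c hc⟩

namespace RealNode

variable (C : G.RealNode)

/-- The stochastic nodes over which the expected value of `C` is taken. -/
abbrev sources : Set G.Node := G.stochBefore C.node

/-- The value of `C` given the values of stochastic nodes. -/
def value (θ : G.Node) {A : Set G.Node} (x : G.Assign A) (hA : G.Known A C.node) :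
    ADFun (G.Val θ) ℝ := fun t s => cast C.real (val θ x C.node hA t s)

theorem known_sources : G.Known C.sources C.node := by
  intro _ hs h
  refine ⟨hs, ?_⟩
  rcases Relation.reflTransGen_iff_eq_or_transGen.1 h with h | h
  · exact absurd (h ▸ hs) C.det
  · exact h

theorem known_of_mem_sources {v : G.Node} (hv : v ∈ C.sources) : G.Known C.sources v :=
  fun _ hs h => ⟨hs, Relation.TransGen.trans_right h hv.2⟩

open scoped Classical in
/-- The integrand `p(x) C(x)` of the expected value: the joint density of all stochastic nodes that
influence `C`, times the value of `C`. -/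
def integrand (θ : G.Node) (x : G.Assign C.sources) : ADFun (G.Val θ) ℝ := fun t s =>
  (∏ v : C.sources, nodeDens θ x v v.2.1 (C.known_of_mem_sources v.2) t s) *
    C.value θ x C.known_sources t s

open scoped Classical in
/-- The reference measure on the values of the stochastic nodes in `A`. -/
def _root_.SCG.refMeasure (A : Set G.Node) : Measure (G.Assign A) :=
  Measure.pi fun v : A => G.ref v

/-- The expected value of `C`. -/
def expect (θ : G.Node) : ADFun (G.Val θ) ℝ := fun t s =>
  ∫ x, C.integrand θ x t s ∂(refMeasure C.sources)

end RealNode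

/-! ### Ordered partitions of the stochastic nodes -/

/-- A topologically sorted partition of the stochastic nodes that influence `C` into `k` parts:
`idx` says in which part a node is, and nodes never influence nodes of earlier parts. -/
structure TopPartition (C : G.RealNode) (k : ℕ) where
  idx : C.sources → Fin k
  sorted : ∀ s s' : C.sources, Relation.TransGen G.edge s s' → idx s ≤ idx s'

namespace TopPartition

variable {C : G.RealNode} {k : ℕ} (P : TopPartition C k)

/-- The nodes of the parts before part `i` (parts are numbered from `0`). -/
def before (i : ℕ) : Set G.Node := {s | ∃ h : s ∈ C.sources, (P.idx ⟨s, h⟩ : ℕ) < i}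

/-- The nodes of part `i`. -/
def part (i : ℕ) : Set G.Node := {s | ∃ h : s ∈ C.sources, (P.idx ⟨s, h⟩ : ℕ) = i}

/-- The values of all parts before part `i`. -/
abbrev Past (i : ℕ) : Type := G.Assign (P.before i)

/-- The values of part `i`. -/
abbrev Block (i : ℕ) : Type := G.Assign (P.part i)

/-- The samples that a proposal distribution for part `i` draws. -/
abbrev Sample (i : ℕ) : Type := FinSample (P.Block i)

/-- The empty assignment, before the first part. -/
def nil : P.Past 0 := fun s => absurd s.2.choose_spec (Nat.not_lt_zero _)

theorem mem_part_of_not_before {i : ℕ} {s : G.Node} (h : s ∈ P.before (i + 1))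
    (h' : s ∉ P.before i) : s ∈ P.part i := by
  obtain ⟨hs, hi⟩ := h
  exact ⟨hs, le_antisymm (Nat.lt_succ_iff.1 hi) (not_lt.1 fun hlt => h' ⟨hs, hlt⟩)⟩

open scoped Classical in
/-- Add the values of part `i` to the values of the parts before it. -/
def snoc {i : ℕ} (x : P.Past i) (y : P.Block i) : P.Past (i + 1) := fun s =>
  if h : (s : G.Node) ∈ P.before i then x ⟨s, h⟩ else y ⟨s, P.mem_part_of_not_before s.2 h⟩

theorem measurable_snoc (i : ℕ) :
    Measurable fun p : P.Past i × P.Block i => P.snoc p.1 p.2 := by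
  refine measurable_pi_iff.2 fun s => ?_
  by_cases h : (s : G.Node) ∈ P.before i
  · simp only [snoc, h, dif_pos]
    exact (measurable_pi_apply _).comp measurable_fst
  · simp only [snoc, h, dif_neg, not_false_eq_true]
    exact (measurable_pi_apply _).comp measurable_snd

theorem known_part {i : ℕ} {v : G.Node} (hv : v ∈ P.part i) : G.Known (P.before (i + 1)) v := by
  obtain ⟨hC, hi⟩ := hv
  intro s hs h
  have hsC : s ∈ C.sources := ⟨hs, Relation.TransGen.trans_right h hC.2⟩
  refine ⟨hsC, Nat.lt_succ_of_le ?_⟩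
  rw [← hi]
  rcases Relation.reflTransGen_iff_eq_or_transGen.1 h with h | h
  · subst h
    exact le_rfl
  · exact P.sorted ⟨s, hsC⟩ ⟨v, hC⟩ h

theorem known_end : G.Known (P.before k) C.node := fun _ hs h =>
  ⟨C.known_sources _ hs h, Fin.is_lt _⟩

variable (θ : G.Node)

open scoped Classical in
/-- The conditional density of the values `y` of part `i`, given the values `x` of earlier parts. -/
def blockDens {i : ℕ} (x : P.Past i) (y : P.Block i) : ADFun (G.Val θ) ℝ := fun t s =>
  ∏ v : P.part i, nodeDens θ (P.snoc x y) v v.2.choose.1 (P.known_part v.2) t s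

/-- The expectation of `f` over the values of part `i`, given the values `x` of earlier parts. -/
def blockExpect {i : ℕ} (x : P.Past i) (f : P.Block i → ADFun (G.Val θ) ℝ) :
    ADFun (G.Val θ) ℝ := fun t s =>
  ∫ y, P.blockDens θ x y t s * f y t s ∂(refMeasure (P.part i))

/-- The value of `C` given the values of all parts. -/
def finalCost {i : ℕ} (h : i + 0 = k) (x : P.Past i) : ADFun (G.Val θ) ℝ :=
  C.value θ x (by subst h; exact P.known_end)

/-- The conditional expectation of `C` over the last `r` parts, given the values `x` of the first
`i` parts. -/
def condCost : (r i : ℕ) → i + r = k → P.Past i → ADFun (G.Val θ) ℝ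
  | 0, _, h, x => P.finalCost θ h x
  | r + 1, i, h, x => P.blockExpect θ x fun y => condCost r (i + 1) (by omega) (P.snoc x y)

/-! ### Gradient estimators and the surrogate loss -/

/-- A gradient estimator `⟨q, w, l, a⟩` for part `i`: a proposal distribution for a finite sample
of values of the part given the values of the earlier parts; a nonnegative weighting function; a
gradient function; and a control variate. The last three are evaluated at each value of the sample,
`j` being its position; they may depend on the earlier values and on the rest of the sample. -/
structure GradEstimator (i : ℕ) where
  q : ADFun (G.Val θ) (Kernel (P.Past i) (P.Sample i))
  q_prob : ∀ t, IsMarkovKernel (q.forward t)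
  w : P.Past i → (X : P.Sample i) → Fin X.1 → ADFun (G.Val θ) ℝ
  w_nonneg : ∀ x X j t, 0 ≤ (w x X j).forward t
  l : P.Past i → (X : P.Sample i) → Fin X.1 → ADFun (G.Val θ) ℝ
  a : P.Past i → (X : P.Sample i) → Fin X.1 → ADFun (G.Val θ) ℝ

variable {θ}

variable (est : ∀ i : Fin k, GradEstimator P θ i)

/-- All random choices made by the surrogate loss when `r` parts are left, beginning with part `i`:
a sample for part `i` and, for each of its values, the choices for the later parts. -/
def Tree : (r i : ℕ) → Type
  | 0, _ => PUnit
  | r + 1, i => FinSample (P.Block i × Tree r (i + 1))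

instance Tree.instMeasurableSpace : (r i : ℕ) → MeasurableSpace (P.Tree r i)
  | 0, _ => (inferInstance : MeasurableSpace PUnit)
  | r + 1, i =>
    letI := Tree.instMeasurableSpace r (i + 1)
    (inferInstance : MeasurableSpace (FinSample (P.Block i × P.Tree r (i + 1))))

/-- The joint law of all random choices given the values of the earlier parts, at the input `t`:
the sample for part `i` is drawn from its proposal distribution, and then the later choices are made
independently for each of the values in the sample, conditionally on that value. -/
def treeLawAux (t : G.Val θ) :
    (r i : ℕ) → i + r = k → {κ : Kernel (P.Past i) (P.Tree r i) // IsMarkovKernel κ}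
  | 0, i, _ =>
    let κ : Kernel (P.Past i) PUnit := Kernel.const _ (Measure.dirac PUnit.unit)
    ⟨κ, (inferInstance : IsMarkovKernel κ)⟩
  | r + 1, i, h =>
    let e := est ⟨i, by omega⟩
    let κ := treeLawAux t r (i + 1) (by omega)
    haveI := κ.2
    haveI : IsMarkovKernel (e.q.forward t) := e.q_prob t
    let κ' : Kernel (P.Past i) (FinSample (P.Block i × P.Tree r (i + 1))) :=
      (e.q.forward t ⊗ₖ branch (κ.1.comap _ (P.measurable_snoc i))).snd
    ⟨κ', (inferInstance : IsMarkovKernel κ')⟩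

/-- The law of all random choices made by the surrogate loss. -/
def treeLaw (t : G.Val θ) : Measure (P.Tree k 0) :=
  (treeLawAux P est t k 0 (Nat.zero_add k)).1 P.nil

/-- The surrogate loss of the last `r` parts, beginning with part `i`, for the random choices `T`,
given the values `x` of the earlier parts and the sum `L` of their gradient functions. -/
def surrogateAux : (r i : ℕ) → i + r = k → P.Past i → ADFun (G.Val θ) ℝ → P.Tree r i →
    ADFun (G.Val θ) ℝ
  | 0, _, h, x, L, _ => L.magic * P.finalCost θ h x
  | r + 1, i, h, x, L, T =>
    let e := est ⟨i, by omega⟩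
    let X : P.Sample i := ⟨T.1, fun j => (T.2 j).1⟩
    ∑ j : Fin X.1, e.w x X j * (L.magic * e.a x X j +
      surrogateAux r (i + 1) (by omega) (P.snoc x (X.2 j)) (L + e.l x X j) (T.2 j).2)

/-- The surrogate loss, for the random choices `T`. -/
def surrogate (T : P.Tree k 0) : ADFun (G.Val θ) ℝ :=
  surrogateAux P est k 0 (Nat.zero_add k) P.nil 0 T

variable [NormedAddCommGroup (G.Val θ)] [NormedSpace ℝ (G.Val θ)]

/-- The last `r` levels of nested expectations over the proposal distributions, beginning with part
`i`, in the expectation of the evaluated `n`-th derivative of the surrogate loss, given the values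
`x` of the earlier parts, the product `W` of their weights and the sum `L` of their gradient
functions. -/
def nestedMeanAux (n : ℕ) (t : G.Val θ) : (r i : ℕ) → i + r = k → P.Past i →
    ADFun (G.Val θ) ℝ → ADFun (G.Val θ) ℝ → (G.Val θ) [×n]→L[ℝ] ℝ
  | 0, _, h, x, W, L => ((W * L.magic * P.finalCost θ h x).grad n).forward t
  | r + 1, i, h, x, W, L =>
    let e := est ⟨i, by omega⟩
    ∫ X, ∑ j : Fin X.1, (((W * e.w x X j * L.magic * e.a x X j).grad n).forward t +
      nestedMeanAux n t r (i + 1) (by omega) (P.snoc x (X.2 j)) (W * e.w x X j) (L + e.l x X j))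
      ∂(e.q.forward t x)

/-- The nested expectation, over the proposal distributions of all parts, of the evaluated `n`-th
derivative of the surrogate loss. -/
def nestedMean (n : ℕ) (t : G.Val θ) : (G.Val θ) [×n]→L[ℝ] ℝ :=
  nestedMeanAux P est n t k 0 (Nat.zero_add k) P.nil 1 0

namespace GradEstimator

variable {P} {i : ℕ} (e : GradEstimator P θ i)

/-- Weights, gradient functions and control variates are `n` times continuously differentiable. -/
def Smooth (n : ℕ) (t : G.Val θ) : Prop :=
  ∀ x X j, (e.w x X j).SmoothAt n t ∧ (e.l x X j).SmoothAt n t ∧ (e.a x X j).SmoothAt n t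

/-- Up to order `n`, the local surrogate loss of each function in `𝓕` is an unbiased estimator of
the derivatives of its expectation over part `i`. -/
def UnbiasedSurrogate (𝓕 : P.Past i → Set (P.Block i → ADFun (G.Val θ) ℝ)) (n : ℕ)
    (t : G.Val θ) : Prop :=
  ∀ x, ∀ f ∈ 𝓕 x, ∀ m ≤ n, HasMean (e.q.forward t x)
    (fun X => ∑ j, ((e.w x X j * (e.l x X j).magic * f (X.2 j)).grad m).forward t)
    (((P.blockExpect θ x f).grad m).forward t)

/-- Up to order `n`, the weighted control variate has mean zero. -/
def ZeroMeanControl (n : ℕ) (t : G.Val θ) : Prop :=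
  ∀ x, ∀ m ≤ n, HasMean (e.q.forward t x)
    (fun X => ∑ j, ((e.w x X j * e.a x X j).grad m).forward t) 0

/-- The derivatives of the weights of the orders `1, …, n` have mean zero. -/
def ZeroMeanWeightGrad (n : ℕ) (t : G.Val θ) : Prop :=
  ∀ x, ∀ m ≤ n, 0 < m → HasMean (e.q.forward t x)
    (fun X => ∑ j, ((e.w x X j).grad m).forward t) 0

/-- The proposal distribution is invariant under forward mode. -/
def ForwardInvariant : Prop := ∀ t s, e.q t s = e.q.forward t

end GradEstimator

end TopPartition

end SCG

end

/-! The proof generalises over what earlier parts hand down, a product of weights W and a sum of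
gradient functions L, and shows that the nested mean of the remaining levels is the evaluated n-th
derivative of W · magic(L) times the conditional expectation of C given the past. This is
`nestedMeanAux_eq_grad`, by induction on the number of parts left. As magic(L + l) = magic(L) ·
magic(l), the factor F = W · magic(L) splits off the current part. By the Leibniz rule the n-th
derivative of F · g at a point is a linear function, depending only on F, of the derivatives of g up
to order n. It therefore commutes with the expectation over samples (`hasMean_grad_mul`), and this
is why the local conditions are used at all orders m ≤ n. Unbiasedness then produces the conditional
expectation one level up, and the control variates contribute zero.

At the top, W = 1 and L = 0. Fubini (`condCost_nil`) together with identity under evaluation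
identifies the iterated conditional expectation with the expected cost on a neighbourhood of the
point, so the derivatives agree.

For the joint law, `integral_grad_surrogateAux` unrolls the tree of samples. The derivative is a sum
of terms that each see one continuation, and by independence its integrability passes to each term,
hence down to every level. -/

noncomputable section

/-! ### Leibniz rule at a point. -/

/-- Leibniz rule, in a qualitative form: at a given point, the `n`-th derivative of `B f g` is a sum
of continuous linear images of the derivatives of `g` up to order `n`. -/
theorem exists_clm_iteratedFDeriv_bilinear {E : Type} [NormedAddCommGroup E] [NormedSpace ℝ E]
    (n : ℕ) : ∀ {F G H : Type} [NormedAddCommGroup F] [NormedSpace ℝ F]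
    [NormedAddCommGroup G] [NormedSpace ℝ G] [NormedAddCommGroup H] [NormedSpace ℝ H]
    (B : F →L[ℝ] G →L[ℝ] H) (f : E → F) (x : E), ContDiffAt ℝ n f x →
    ∃ Λ : ∀ m, (E [×m]→L[ℝ] G) →L[ℝ] (E [×n]→L[ℝ] H), ∀ g : E → G, ContDiffAt ℝ n g x →
      iteratedFDeriv ℝ n (fun y => B (f y) (g y)) x =
        ∑ m ∈ Finset.range (n + 1), Λ m (iteratedFDeriv ℝ m g x) := by
  -- The spaces and `B` stay general: differentiating once replaces `B` by `B.precompR E` and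
  -- `B.precompL E`, whose arguments and values lie in other spaces.
  induction n with
  | zero =>
    intro F G H _ _ _ _ _ _ B f x _
    -- Only m = 0 occurs in the sum, so the value 0 at the other orders is arbitrary.
    refine ⟨fun m => match m with
      | 0 => ((continuousMultilinearCurryFin0 ℝ E H).symm.toContinuousLinearEquiv :
          H →L[ℝ] E [×0]→L[ℝ] H) ∘L B (f x) ∘L
          ((continuousMultilinearCurryFin0 ℝ E G).toContinuousLinearEquiv :
            (E [×0]→L[ℝ] G) →L[ℝ] G)
      | _ + 1 => 0, fun g _ => ?_⟩
    ext v
    simp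
  | succ n ih =>
    intro F G H _ _ _ _ _ _ B f x hf
    obtain ⟨Λ, hΛ⟩ := ih (B.precompR E) f x (hf.of_le (by norm_cast; omega))
    obtain ⟨Λ', hΛ'⟩ := ih (B.precompL E) (fderiv ℝ f) x (hf.fderiv_right (by norm_cast))
    let R (m : ℕ) (K : Type) [NormedAddCommGroup K] [NormedSpace ℝ K] :
        (E [×m]→L[ℝ] E →L[ℝ] K) ≃L[ℝ] (E [×(m + 1)]→L[ℝ] K) :=
      (continuousMultilinearCurryRightEquiv' ℝ m E K).symm.toContinuousLinearEquiv
    have hR (m : ℕ) (K : Type) [NormedAddCommGroup K] [NormedSpace ℝ K] (h : E → K) :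
        iteratedFDeriv ℝ (m + 1) h x = R m K (iteratedFDeriv ℝ m (fderiv ℝ h) x) :=
      iteratedFDeriv_succ_eq_comp_right
    -- Order m + 1 of g arises from order m of Dg in B(f, Dg) and from order m + 1 of g in B(Df, g).
    -- The latter term is differentiated only n times, hence the cutoff.
    refine ⟨fun m => match m with
      | 0 => (R n H : _ →L[ℝ] _) ∘L Λ' 0
      | m + 1 => (R n H : _ →L[ℝ] _) ∘L (Λ m ∘L ((R m G).symm : _ →L[ℝ] _) +
          if m + 1 ≤ n then Λ' (m + 1) else 0), fun g hg => ?_⟩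
    have hev {K : Type} [NormedAddCommGroup K] [NormedSpace ℝ K] {h : E → K}
        (hh : ContDiffAt ℝ (n + 1 : ℕ) h x) : ∀ᶠ y in 𝓝 x, DifferentiableAt ℝ h y :=
      (hh.eventually (by simp)).mono fun y hy => hy.differentiableAt (by simp)
    have hfd : fderiv ℝ (fun y => B (f y) (g y)) =ᶠ[𝓝 x]
        ((fun y => B.precompR E (f y) (fderiv ℝ g y)) +
          fun y => B.precompL E (fderiv ℝ f y) (g y)) := by
      filter_upwards [hev hf, hev hg] with y hy hy'
      exact B.fderiv_of_bilinear hy hy'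
    have hf0 : ContDiffAt ℝ n f x := hf.of_le (by norm_cast; omega)
    have hg0 : ContDiffAt ℝ n g x := hg.of_le (by norm_cast; omega)
    have hf1 : ContDiffAt ℝ n (fderiv ℝ f) x := hf.fderiv_right (by norm_cast)
    have hg1 : ContDiffAt ℝ n (fderiv ℝ g) x := hg.fderiv_right (by norm_cast)
    have hc1 : ContDiffAt ℝ n (fun y => B.precompR E (f y) (fderiv ℝ g y)) x :=
      (B.precompR E).isBoundedBilinearMap.contDiff.contDiffAt.comp x (hf0.prodMk hg1)
    have hc2 : ContDiffAt ℝ n (fun y => B.precompL E (fderiv ℝ f y) (g y)) x :=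
      (B.precompL E).isBoundedBilinearMap.contDiff.contDiffAt.comp x (hf1.prodMk hg0)
    rw [hR, (hfd.iteratedFDeriv ℝ n).eq_of_nhds, iteratedFDeriv_add_apply hc1 hc2, hΛ _ hg1,
      hΛ' _ hg0, Finset.sum_range_succ' _ (n + 1)]
    have h1 : ∑ m ∈ Finset.range (n + 1), (if m + 1 ≤ n then Λ' (m + 1) else 0)
        (iteratedFDeriv ℝ (m + 1) g x) =
        ∑ m ∈ Finset.range n, Λ' (m + 1) (iteratedFDeriv ℝ (m + 1) g x) := by
      rw [Finset.sum_range_succ]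
      simp only [add_le_iff_nonpos_right, nonpos_iff_eq_zero, one_ne_zero, if_false,
        zero_apply, add_zero]
      exact Finset.sum_congr rfl fun m hm => by rw [if_pos (Nat.succ_le_of_lt (Finset.mem_range.1 hm))]
    have h2 (m : ℕ) : (R m G).symm (iteratedFDeriv ℝ (m + 1) g x) =
        iteratedFDeriv ℝ m (fderiv ℝ g) x := by
      rw [hR, ContinuousLinearEquiv.symm_apply_apply]
    simp only [ContinuousLinearMap.comp_apply, add_apply,
      ContinuousLinearEquiv.coe_coe, h2, ← map_sum, Finset.sum_add_distrib, h1]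
    rw [← map_add, Finset.sum_range_succ' (fun m => Λ' m _) n, ← add_assoc]

theorem exists_clm_iteratedFDeriv_mul {E : Type} [NormedAddCommGroup E] [NormedSpace ℝ E]
    {n : ℕ} {f : E → ℝ} {x : E} (hf : ContDiffAt ℝ n f x) :
    ∃ Λ : ∀ m, (E [×m]→L[ℝ] ℝ) →L[ℝ] (E [×n]→L[ℝ] ℝ), ∀ g : E → ℝ, ContDiffAt ℝ n g x →
      iteratedFDeriv ℝ n (f * g) x =
        ∑ m ∈ Finset.range (n + 1), Λ m (iteratedFDeriv ℝ m g x) :=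
  exists_clm_iteratedFDeriv_bilinear n (ContinuousLinearMap.mul ℝ ℝ) f x hf

/-! ### Independent continuations of a finite sample. -/

/-- If a sum of functions of the individual coordinates is integrable for a product of probability
measures, then each summand is integrable. -/
theorem integrable_of_integrable_sum_pi {m : ℕ} {X : Fin m → Type} [∀ j, MeasurableSpace (X j)]
    (μ : ∀ j, Measure (X j)) [∀ j, IsProbabilityMeasure (μ j)] {B : Type} [NormedAddCommGroup B]
    (H : ∀ j, X j → B) (hH : Integrable (fun x => ∑ j, H j (x j)) (Measure.pi μ)) (j : Fin m) :
    Integrable (H j) (μ j) := by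
  obtain _ | m := m
  · exact j.elim0
  -- With coordinate j split off, almost every choice y of the other coordinates leaves an
  -- integrable section, and that section differs from `H j` only by a constant.
  have h := (measurePreserving_piFinSuccAbove μ j).symm.integrable_comp_of_integrable hH
  have h' := h.prod_left_ae
  obtain ⟨y, hy⟩ := h'.exists
  have : Integrable (fun x => H j x + ∑ i, H (j.succAbove i) (y i)) (μ j) := by
    refine hy.congr (Filter.Eventually.of_forall fun x => ?_)
    change ∑ i, H i (Fin.insertNth (α := X) j x y i) = _
    simp [Fin.sum_univ_succAbove _ j]
  refine (this.sub (integrable_const (∑ i, H (j.succAbove i) (y i)))).congr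
    (Filter.Eventually.of_forall fun x => ?_)
  simp

theorem integral_sum_pi {m : ℕ} {X : Fin m → Type} [∀ j, MeasurableSpace (X j)]
    (μ : ∀ j, Measure (X j)) [∀ j, IsProbabilityMeasure (μ j)] {B : Type} [NormedAddCommGroup B]
    [NormedSpace ℝ B] (H : ∀ j, X j → B) (hH : ∀ j, Integrable (H j) (μ j)) :
    ∫ x, ∑ j, H j (x j) ∂(Measure.pi μ) = ∑ j, ∫ y, H j y ∂(μ j) := by
  rw [integral_finsetSum _ fun j _ => integrable_comp_eval (hH j)]
  refine Finset.sum_congr rfl fun j _ => ?_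
  exact integral_comp_eval (hH j).aestronglyMeasurable

/-- The law of the outcome of a branching, as an image of the product of the laws of the
continuations. -/
theorem branch_apply {H X Y : Type} [MeasurableSpace H] [MeasurableSpace X] [MeasurableSpace Y]
    (κ : Kernel (H × X) Y) [IsMarkovKernel κ] (p : H × FinSample X) :
    branch κ p = (Measure.pi fun j => κ (p.1, p.2.2 j)).map
      fun T => FinSample.mk p.2.1 fun j => (p.2.2 j, T j) := by
  -- Pairing with a fixed point pushes each factor forward to Dirac times that factor, and a product
  -- of pushforwards is the pushforward of the product.
  have h : (Measure.pi fun j => κ (p.1, p.2.2 j)).map (fun T j => (p.2.2 j, T j)) =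
      Measure.pi fun j => (Measure.dirac (p.2.2 j)).prod (κ (p.1, p.2.2 j)) := by
    rw [Measure.pi_map_pi (fun j => by fun_prop)]
    simp only [Measure.dirac_prod]
  change Measure.map _ _ = _
  rw [← h, Measure.map_map (measurableEmbedding_sizeMk (X × Y) p.2.1).measurable (by fun_prop)]
  rfl

/-- The mean, over a sample and the continuations of its values, of a sum of functions of the
individual continuations. -/
theorem integral_snd_compProd_branch {H X Y : Type} [MeasurableSpace H] [MeasurableSpace X]
    [MeasurableSpace Y] {B : Type} [NormedAddCommGroup B] [NormedSpace ℝ B]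
    (q : Kernel H (FinSample X)) [IsMarkovKernel q] (κ : Kernel (H × X) Y) [IsMarkovKernel κ]
    (x : H) (g : FinSample (X × Y) → B) (f : (S : FinSample X) → Fin S.1 → Y → B)
    (hgf : ∀ (S : FinSample X) (T : Fin S.1 → Y),
      g (FinSample.mk S.1 fun j => (S.2 j, T j)) = ∑ j, f S j (T j))
    (hg : Integrable g ((q ⊗ₖ branch κ).snd x)) :
    (∀ᵐ S ∂(q x), ∀ j, Integrable (f S j) (κ (x, S.2 j))) ∧
    ∫ T, g T ∂((q ⊗ₖ branch κ).snd x) = ∫ S, ∑ j, ∫ T, f S j T ∂(κ (x, S.2 j)) ∂(q x) := by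
  rw [Kernel.snd_apply] at hg ⊢
  rw [integral_map measurable_snd.aemeasurable hg.aestronglyMeasurable]
  replace hg := hg.comp_measurable measurable_snd
  have hmk (S : FinSample X) :
      Measurable fun T : Fin S.1 → Y => FinSample.mk S.1 fun j => (S.2 j, T j) :=
    (measurableEmbedding_sizeMk (X × Y) S.1).measurable.comp (by fun_prop)
  have key : ∀ᵐ S ∂(q x), (∀ j, Integrable (f S j) (κ (x, S.2 j))) ∧
      ∫ T, g T ∂(branch κ (x, S)) = ∑ j, ∫ T, f S j T ∂(κ (x, S.2 j)) := by
    filter_upwards [((integrable_compProd_iff hg.aestronglyMeasurable).1 hg).1] with S hS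
    simp only [Function.comp_apply, branch_apply] at hS ⊢
    rw [integral_map (hmk S).aemeasurable hS.aestronglyMeasurable]
    replace hS := hS.comp_measurable (hmk S)
    simp only [Function.comp_def, hgf] at hS ⊢
    have hf := integrable_of_integrable_sum_pi (fun j => κ (x, S.2 j)) (f S) hS
    exact ⟨hf, integral_sum_pi (fun j => κ (x, S.2 j)) (f S) hf⟩
  exact ⟨key.mono fun S hS => hS.1,
    (integral_compProd hg).trans (integral_congr_ae (key.mono fun S hS => hS.2))⟩

/-! ### Node values and densities. -/

namespace SCG

variable {G : SCG}

open scoped Classical in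
theorem val_eq (θ : G.Node) {A : Set G.Node} (x : G.Assign A) (v : G.Node) (hv : G.Known A v) :
    val θ x v hv = if h : θ = v then fun t _ => cast (congrArg G.Val h) t
      else if hs : v ∈ G.stoch then fun _ _ => x ⟨v, hv v hs Relation.ReflTransGen.refl⟩
      else fun t s => G.func v hs (fun u => val θ x u (hv.parent u.2) t s)
        (fun u => val θ x u (hv.parent u.2) s s) := by
  rw [val, WellFounded.fix_eq]

/-- The value of a node only depends on the values of the stochastic nodes that influence it. -/
theorem val_congr (θ : G.Node) {A B : Set G.Node} (x : G.Assign A) (x' : G.Assign B) (v : G.Node) :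
    ∀ (hv : G.Known A v) (hv' : G.Known B v),
      (∀ s (hs : s ∈ G.stoch) (h : Relation.ReflTransGen G.edge s v),
        x ⟨s, hv s hs h⟩ = x' ⟨s, hv' s hs h⟩) → val θ x v hv = val θ x' v hv' := by
  induction v using G.edge_wf.induction with
  | _ v ih =>
    intro hv hv' h
    have hu (u : {u // G.edge u v}) : val θ x u (hv.parent u.2) = val θ x' u (hv'.parent u.2) :=
      ih u u.2 _ _ fun s hs hsu => h s hs (hsu.tail u.2)
    rw [val_eq, val_eq]
    split_ifs with h1 h2
    · rfl
    · rw [h v h2 Relation.ReflTransGen.refl]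
    · simp only [hu]

theorem nodeDens_congr (θ : G.Node) {A B : Set G.Node} (x : G.Assign A) (x' : G.Assign B)
    (v : G.Node) (hs : v ∈ G.stoch) (hv : G.Known A v) (hv' : G.Known B v)
    (h : ∀ s (hs : s ∈ G.stoch) (h : Relation.ReflTransGen G.edge s v),
      x ⟨s, hv s hs h⟩ = x' ⟨s, hv' s hs h⟩) :
    nodeDens θ x v hs hv = nodeDens θ x' v hs hv' := by
  have hu (u : {u // G.edge u v}) : val θ x u (hv.parent u.2) = val θ x' u (hv'.parent u.2) :=
    val_congr θ x x' u _ _ fun s hs hsu => h s hs (hsu.tail u.2)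
  funext t s
  simp only [nodeDens, hu, h v hs Relation.ReflTransGen.refl]

/-- Induction along the edges: the parameter reads the live input, sampled values are constants, and
node functions preserve the property. -/
theorem IdenticalUnderEval.val (hG : G.IdenticalUnderEval) (θ : G.Node) {A : Set G.Node}
    (x : G.Assign A) (v : G.Node) : ∀ hv : G.Known A v, (val θ x v hv).IdenticalUnderEval := by
  induction v using G.edge_wf.induction with
  | _ v ih =>
    intro hv t s
    rw [val_eq]
    split_ifs with h1 h2
    · rfl
    · rfl
    · simp only [ADFun.forward]
      rw [hG.1 v h2 _ _, ADFun.forward]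
      simp only [fun u : {u // G.edge u v} => ih u u.2 (hv.parent u.2) t s, ADFun.forward]

theorem IdenticalUnderEval.nodeDens (hG : G.IdenticalUnderEval) (θ : G.Node) {A : Set G.Node}
    (x : G.Assign A) (v : G.Node) (hs : v ∈ G.stoch) (hv : G.Known A v) :
    (nodeDens θ x v hs hv).IdenticalUnderEval := by
  intro t s
  simp only [ADFun.forward, SCG.nodeDens]
  rw [hG.2 v hs _ _, ADFun.forward]
  simp only [fun u : {u // G.edge u v} => hG.val θ x u (hv.parent u.2) t s, ADFun.forward]

open scoped Classical in
/-- The joint density of the nodes of `A`, if they are stochastic and determined by each other. -/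
def jointDens (θ : G.Node) {A : Set G.Node} (hA : ∀ v ∈ A, v ∈ G.stoch ∧ G.Known A v)
    (x : G.Assign A) : ADFun (G.Val θ) ℝ := fun t s =>
  ∏ v : A, nodeDens θ x v (hA v v.2).1 (hA v v.2).2 t s

instance sigmaFinite_refMeasure (A : Set G.Node) : SigmaFinite (refMeasure A) := by
  unfold refMeasure
  infer_instance

/-! ### Fubini along the partition. -/

namespace TopPartition

variable {C : G.RealNode} {k : ℕ} (P : TopPartition C k) (θ : G.Node)

theorem before_mono {i j : ℕ} (h : i ≤ j) : P.before i ⊆ P.before j :=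
  fun _ ⟨hs, hi⟩ => ⟨hs, hi.trans_le h⟩

theorem part_subset_before (i : ℕ) : P.part i ⊆ P.before (i + 1) :=
  fun _ ⟨hs, hi⟩ => ⟨hs, by omega⟩

theorem notMem_before_of_mem_part {i : ℕ} {s : G.Node} (h : s ∈ P.part i) : s ∉ P.before i :=
  fun ⟨_, h'⟩ => by have := h.choose_spec; omega

/-- By sortedness, initial segments are closed under stochastic ancestors, so `jointDens` makes
sense on each of them. -/
theorem known_before {i : ℕ} (v : G.Node) (hv : v ∈ P.before i) :
    v ∈ G.stoch ∧ G.Known (P.before i) v := by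
  obtain ⟨hC, hi⟩ := hv
  refine ⟨hC.1, fun s hs h => ?_⟩
  obtain ⟨hsC, hs'⟩ := P.known_part (i := P.idx ⟨v, hC⟩) ⟨hC, rfl⟩ s hs h
  exact ⟨hsC, by omega⟩

theorem before_eq_sources : P.before k = C.sources :=
  Set.ext fun _ => ⟨fun h => h.choose, fun h => ⟨h, Fin.is_lt _⟩⟩

theorem snoc_of_mem_before {i : ℕ} (x : P.Past i) (y : P.Block i) {s : G.Node}
    (h : s ∈ P.before i) : P.snoc x y ⟨s, P.before_mono i.le_succ h⟩ = x ⟨s, h⟩ :=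
  dif_pos h

theorem snoc_of_mem_part {i : ℕ} (x : P.Past i) (y : P.Block i) {s : G.Node}
    (h : s ∈ P.part i) : P.snoc x y ⟨s, P.part_subset_before i h⟩ = y ⟨s, h⟩ :=
  dif_neg (P.notMem_before_of_mem_part h)

open scoped Classical in
/-- The nodes before part `i + 1` are those before part `i` and those of part `i`. -/
def beforeSuccEquiv (i : ℕ) : P.before i ⊕ P.part i ≃ P.before (i + 1) where
  toFun := Sum.elim (fun s => ⟨s, P.before_mono i.le_succ s.2⟩)
    fun s => ⟨s, P.part_subset_before i s.2⟩
  invFun s := if h : (s : G.Node) ∈ P.before i then Sum.inl ⟨s, h⟩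
    else Sum.inr ⟨s, P.mem_part_of_not_before s.2 h⟩
  left_inv := by
    rintro (s | s)
    · simp
    · simp [P.notMem_before_of_mem_part s.2]
  right_inv s := by
    by_cases h : (s : G.Node) ∈ P.before i <;> simp [h]

open scoped Classical in
theorem prod_before_succ {M : Type} [CommMonoid M] (i : ℕ) (f : P.before (i + 1) → M) :
    ∏ v, f v = (∏ v : P.before i, f ⟨v, P.before_mono i.le_succ v.2⟩) *
      ∏ v : P.part i, f ⟨v, P.part_subset_before i v.2⟩ := by
  rw [← Equiv.prod_comp (P.beforeSuccEquiv i), Fintype.prod_sum_type]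
  rfl

-- It suffices to test boxes, and the preimage of a box is a product of two boxes.
open scoped Classical in
theorem measurePreserving_snoc (i : ℕ) :
    MeasurePreserving (fun p : P.Past i × P.Block i => P.snoc p.1 p.2)
      ((refMeasure (P.before i)).prod (refMeasure (P.part i))) (refMeasure (P.before (i + 1))) := by
  refine ⟨P.measurable_snoc i, (Measure.pi_eq fun s hs => ?_).symm⟩
  rw [Measure.map_apply (P.measurable_snoc i) (MeasurableSet.univ_pi hs)]
  have : (fun p : P.Past i × P.Block i => P.snoc p.1 p.2) ⁻¹' Set.univ.pi s =
      (Set.univ.pi fun v : P.before i => s ⟨v, P.before_mono i.le_succ v.2⟩) ×ˢ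
        Set.univ.pi fun v : P.part i => s ⟨v, P.part_subset_before i v.2⟩ := by
    ext ⟨x, y⟩
    simp only [Set.mem_preimage, Set.mem_pi, Set.mem_univ, true_imp_iff, Set.mem_prod]
    rw [← (P.beforeSuccEquiv i).forall_congr_right, Sum.forall]
    refine and_congr (forall_congr' fun v => ?_) (forall_congr' fun v => ?_)
    · exact iff_of_eq (congrArg (· ∈ _) (P.snoc_of_mem_before x y v.2))
    · exact iff_of_eq (congrArg (· ∈ _) (P.snoc_of_mem_part x y v.2))
  rw [this, Measure.prod_prod, refMeasure, refMeasure, Measure.pi_pi, Measure.pi_pi,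
    P.prod_before_succ]

/-- Chain rule for densities: nodes before part i have all their stochastic ancestors there, so
their densities do not see y. -/
theorem jointDens_snoc {i : ℕ} (x : P.Past i) (y : P.Block i) (t s : G.Val θ) :
    jointDens θ P.known_before (P.snoc x y) t s =
      jointDens θ P.known_before x t s * P.blockDens θ x y t s := by
  classical
  rw [jointDens, prod_before_succ, jointDens, blockDens]
  congr 1
  refine Finset.prod_congr rfl fun v _ => ?_
  rw [nodeDens_congr θ (P.snoc x y) x v (P.known_before v v.2).1 _ (P.known_before v v.2).2
    fun s hs h => P.snoc_of_mem_before x y _]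

/-- This makes differentiation in the live input alone see the whole dependence on the parameter.
Integrals preserve the property because the integrands agree pointwise. -/
theorem identicalUnderEval_condCost (hG : G.IdenticalUnderEval) :
    ∀ (r i : ℕ) (h : i + r = k) (x : P.Past i), (P.condCost θ r i h x).IdenticalUnderEval
  | 0, _, _, x => fun t s => congrArg (cast C.real) (hG.val θ x C.node _ t s)
  | r + 1, i, h, x => fun t s => by
    simp only [condCost, blockExpect, ADFun.forward, blockDens]
    simp only [fun y => identicalUnderEval_condCost hG r (i + 1) (by omega) (P.snoc x y) t s,
      fun y (v : P.part i) =>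
        hG.nodeDens θ (P.snoc x y) v v.2.choose.1 (P.known_part v.2) t s, ADFun.forward]

/-- Fubini's theorem: the integral of the joint density of the first `i` parts times the conditional
expectation of `C` given these parts does not depend on `i`. -/
theorem integral_jointDens_mul_condCost (t : G.Val θ)
    (hint : Integrable (fun x => jointDens θ P.known_before x t t * P.finalCost θ (add_zero k) x t t)
      (refMeasure (P.before k))) :
    ∀ (r i : ℕ) (h : i + r = k),
      Integrable (fun x => jointDens θ P.known_before x t t * P.condCost θ r i h x t t)
        (refMeasure (P.before i)) ∧
      ∫ x, jointDens θ P.known_before x t t * P.condCost θ r i h x t t ∂(refMeasure (P.before i)) =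
        ∫ x, jointDens θ P.known_before x t t * P.finalCost θ (add_zero k) x t t
          ∂(refMeasure (P.before k))
  | 0, i, h => by
    obtain rfl : i = k := h
    exact ⟨hint, rfl⟩
  | r + 1, i, h => by
    obtain ⟨h1, h2⟩ := integral_jointDens_mul_condCost t hint r (i + 1) (by omega)
    have h3 := (P.measurePreserving_snoc i).integrable_comp_of_integrable h1
    have h4 (x : P.Past i) : jointDens θ P.known_before x t t * P.condCost θ (r + 1) i h x t t =
        ∫ y, jointDens θ P.known_before (P.snoc x y) t t *
          P.condCost θ r (i + 1) (by omega) (P.snoc x y) t t ∂(refMeasure (P.part i)) := by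
      simp only [jointDens_snoc, mul_assoc, integral_const_mul]
      rfl
    simp only [h4]
    refine ⟨h3.integral_prod_left, ?_⟩
    rw [← h2, ← (P.measurePreserving_snoc i).map_eq, integral_map (P.measurable_snoc i).aemeasurable
      (by rw [(P.measurePreserving_snoc i).map_eq]; exact h1.aestronglyMeasurable)]
    exact (integral_prod _ h3).symm

instance isEmpty_before_zero : IsEmpty (P.before 0) :=
  ⟨fun s => absurd s.2.choose_spec (Nat.not_lt_zero _)⟩

/-- Assignments on `P.before k` and on `C.sources` have types that are only propositionally equal; a
variable set `A` allows substitution. -/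
theorem _root_.SCG.RealNode.integral_jointDens_mul_value {A : Set G.Node} (hA : A = C.sources)
    (hA' : ∀ v ∈ A, v ∈ G.stoch ∧ G.Known A v) (hC : G.Known A C.node) (t : G.Val θ)
    (hint : Integrable (fun x => (C.integrand θ x).forward t) (refMeasure C.sources)) :
    Integrable (fun x => jointDens θ hA' x t t * C.value θ x hC t t) (refMeasure A) ∧
    ∫ x, jointDens θ hA' x t t * C.value θ x hC t t ∂(refMeasure A) = (C.expect θ).forward t := by
  subst hA
  exact ⟨hint, rfl⟩

/-- The iterated conditional expectation of `C` over all parts is the expected value of `C`. -/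
theorem condCost_nil (t : G.Val θ)
    (hint : Integrable (fun x => (C.integrand θ x).forward t) (refMeasure C.sources)) :
    P.condCost θ k 0 (zero_add k) P.nil t t = (C.expect θ).forward t := by
  obtain ⟨h1, h2⟩ := RealNode.integral_jointDens_mul_value θ P.before_eq_sources P.known_before
    P.known_end t hint
  rw [← h2]
  refine Eq.trans ?_ (P.integral_jointDens_mul_condCost θ t h1 k 0 (zero_add k)).2
  -- Before the first part there is a single assignment, of mass 1 and with empty density product 1,
  -- so the integral is the integrand's value there.
  have : refMeasure (P.before 0) Set.univ = 1 := by
    classical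
    rw [refMeasure, Measure.pi_univ]
    simp
  rw [integral_unique, Measure.real, this, Subsingleton.elim default P.nil, jointDens]
  simp

end TopPartition

end SCG

/-! ### Calculus of the magic box and of evaluated derivatives. -/

namespace ADFun

variable {E : Type}

theorem magic_add (L L' : ADFun E ℝ) : (L + L').magic = L.magic * L'.magic := by
  funext t s
  simp only [magic, stopGrad, Pi.add_apply, Pi.mul_apply, ← Real.exp_add]
  congr 1
  ring

theorem magic_zero : (0 : ADFun E ℝ).magic = 1 := by
  funext t s
  simp [magic, stopGrad]

variable [NormedAddCommGroup E] [NormedSpace ℝ E] {n : ℕ} {t : E} {F F' : ADFun E ℝ}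

theorem SmoothAt.mul (h : F.SmoothAt n t) (h' : F'.SmoothAt n t) : (F * F').SmoothAt n t :=
  ContDiffAt.mul h h'

theorem SmoothAt.add (h : F.SmoothAt n t) (h' : F'.SmoothAt n t) : (F + F').SmoothAt n t :=
  ContDiffAt.add h h'

/-- The stopped term is constant in the live input. -/
theorem SmoothAt.magic (h : F.SmoothAt n t) : F.magic.SmoothAt n t :=
  (ContDiffAt.sub h contDiffAt_const).exp

theorem SmoothAt.sum {ι : Type} {s : Finset ι} {f : ι → ADFun E ℝ}
    (h : ∀ j ∈ s, (f j).SmoothAt n t) : (∑ j ∈ s, f j).SmoothAt n t := by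
  have : (fun u => (∑ j ∈ s, f j) u t) = fun u => ∑ j ∈ s, f j u t := by
    funext u
    simp
  rw [SmoothAt, this]
  exact ContDiffAt.sum h

theorem grad_add (h : F.SmoothAt n t) (h' : F'.SmoothAt n t) :
    ((F + F').grad n).forward t = (F.grad n).forward t + (F'.grad n).forward t :=
  iteratedFDeriv_add_apply h h'

theorem grad_sum {ι : Type} {s : Finset ι} {f : ι → ADFun E ℝ}
    (h : ∀ j ∈ s, (f j).SmoothAt n t) :
    ((∑ j ∈ s, f j).grad n).forward t = ∑ j ∈ s, ((f j).grad n).forward t := by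
  have : (fun u => (∑ j ∈ s, f j) u t) = ∑ j ∈ s, fun u => f j u t := by
    funext u
    simp
  rw [forward, grad, this]
  exact iteratedFDeriv_sum_apply h

/-- The derivative of a product with a smooth factor commutes with expectations of sums over finite
samples. -/
theorem SmoothAt.hasMean_grad_mul {X : Type} [MeasurableSpace X] {q : Measure (FinSample X)}
    (hF : F.SmoothAt n t) {g : (x : FinSample X) → Fin x.1 → ADFun E ℝ}
    (hg : ∀ x j, (g x j).SmoothAt n t) {c : ADFun E ℝ} (hc : c.SmoothAt n t)
    (h : ∀ m ≤ n, HasMean q (fun x => ∑ j, ((g x j).grad m).forward t) ((c.grad m).forward t)) :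
    HasMean q (fun x => ∑ j, ((F * g x j).grad n).forward t) (((F * c).grad n).forward t) := by
  -- The maps depend on F alone, so the same ones serve every `g x j` and the target `c`.
  obtain ⟨Λ, hΛ⟩ := exists_clm_iteratedFDeriv_mul hF
  have h1 : (fun x : FinSample X => ∑ j, ((F * g x j).grad n).forward t) =
      fun x => ∑ m ∈ Finset.range (n + 1), Λ m (∑ j, ((g x j).grad m).forward t) := by
    funext x
    simp only [map_sum]
    rw [Finset.sum_comm]
    exact Finset.sum_congr rfl fun j _ => hΛ _ (hg x j)
  have h2 (m : ℕ) (hm : m ∈ Finset.range (n + 1)) :=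
    h m (Nat.lt_succ_iff.1 (Finset.mem_range.1 hm))
  rw [h1]
  refine ⟨integrable_finsetSum _ fun m hm => (Λ m).integrable_comp (h2 m hm).1, ?_⟩
  rw [integral_finsetSum _ fun m hm => (Λ m).integrable_comp (h2 m hm).1]
  refine (Finset.sum_congr rfl fun m hm => ?_).trans (hΛ _ hc).symm
  rw [(Λ m).integral_comp_comm (h2 m hm).1, (h2 m hm).2]
  rfl

end ADFun

/-! ### Nested expectations and the joint law. -/

namespace SCG

namespace TopPartition

variable {G : SCG} {C : G.RealNode} {k : ℕ} (P : TopPartition C k) {θ : G.Node}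
  [NormedAddCommGroup (G.Val θ)] [NormedSpace ℝ (G.Val θ)]
  (est : ∀ i : Fin k, GradEstimator P θ i) {n : ℕ} {θ₀ : G.Val θ}

/-- W and L must be arbitrary, since each level multiplies W by its weight and adds its gradient
function to L. Unbiasedness is needed only for the conditional expectations of C, hence the
singleton classes. -/
theorem nestedMeanAux_eq_grad (hest : ∀ i, (est i).Smooth n θ₀)
    (hC : ∀ (r i : ℕ) (h : i + 1 + r = k) (x : P.Past i) (y : P.Block i),
      (P.condCost θ r (i + 1) h (P.snoc x y)).SmoothAt n θ₀)
    (h1 : ∀ (r i : ℕ) (h : i + 1 + r = k), (est ⟨i, by omega⟩).UnbiasedSurrogate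
      (fun x => {fun y => P.condCost θ r (i + 1) h (P.snoc x y)}) n θ₀)
    (h2 : ∀ i, (est i).ZeroMeanControl n θ₀) :
    ∀ (r i : ℕ) (h : i + r = k) (x : P.Past i) (W L : ADFun (G.Val θ) ℝ), W.SmoothAt n θ₀ →
      L.SmoothAt n θ₀ → (P.condCost θ r i h x).SmoothAt n θ₀ →
      P.nestedMeanAux est n θ₀ r i h x W L =
        ((W * L.magic * P.condCost θ r i h x).grad n).forward θ₀
  | 0, _, _, _, _, _, _, _, _ => rfl
  | r + 1, i, h, x, W, L, hW, hL, hc => by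
    let e := est ⟨i, by omega⟩
    have hi (X : P.Sample i) (j : Fin X.1) := hest ⟨i, by omega⟩ x X j
    have hWL := hW.mul hL.magic
    have h0 (m : ℕ) : ((0 : ADFun (G.Val θ) ℝ).grad m).forward θ₀ = 0 :=
      congrFun iteratedFDeriv_fun_zero θ₀
    have ha := hWL.hasMean_grad_mul (q := e.q.forward θ₀ x)
      (fun X j => (hi X j).1.mul (hi X j).2.2) (c := 0) contDiffAt_const (fun m hm => by
        rw [h0]
        exact h2 ⟨i, by omega⟩ x m hm)
    -- The block expectation of the next conditional expectation is, by definition, the current one;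
    -- `hc` supplies its smoothness.
    have hf := hWL.hasMean_grad_mul (q := e.q.forward θ₀ x)
      (fun X j => ((hi X j).1.mul (hi X j).2.1.magic).mul (hC r i (by omega) x (X.2 j))) hc
      (fun m hm => h1 r i (by omega) x _ rfl m hm)
    rw [mul_zero, h0] at ha
    rw [← hf.2, ← zero_add (integral _ _), ← ha.2, ← integral_add ha.1 hf.1]
    refine integral_congr_ae (Filter.Eventually.of_forall fun X => ?_)
    simp only [← Finset.sum_add_distrib]
    refine Finset.sum_congr rfl fun j _ => ?_
    rw [nestedMeanAux_eq_grad hest hC h1 h2 r (i + 1) (by omega) _ _ _ (hW.mul (hi X j).1)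
      (hL.add (hi X j).2.1) (hC r i (by omega) x (X.2 j)), ADFun.magic_add]
    exact congrArg₂ (· + ·) (congrArg (fun F : ADFun (G.Val θ) ℝ => (F.grad n).forward θ₀) (by ring))
      (congrArg (fun F : ADFun (G.Val θ) ℝ => (F.grad n).forward θ₀) (by ring))

/-- For a fixed tree the loss is a finite expression in smooth terms. Smoothness is what lets
derivatives distribute over its sums. -/
theorem smoothAt_surrogateAux (hest : ∀ i, (est i).Smooth n θ₀)
    (hC : ∀ (r i : ℕ) (h : i + 1 + r = k) (x : P.Past i) (y : P.Block i),
      (P.condCost θ r (i + 1) h (P.snoc x y)).SmoothAt n θ₀) :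
    ∀ (r i : ℕ) (h : i + r = k) (x : P.Past i) (L : ADFun (G.Val θ) ℝ) (T : P.Tree r i),
      L.SmoothAt n θ₀ → (P.condCost θ r i h x).SmoothAt n θ₀ →
      (P.surrogateAux est r i h x L T).SmoothAt n θ₀
  | 0, _, _, _, _, _, hL, hc => hL.magic.mul hc
  | r + 1, i, h, x, L, T, hL, hc => ADFun.SmoothAt.sum fun j _ => by
    obtain ⟨hw, hl, ha⟩ := hest ⟨i, by omega⟩ x ⟨T.1, fun j => (T.2 j).1⟩ j
    exact hw.mul ((hL.magic.mul ha).add (smoothAt_surrogateAux hest hC r (i + 1) (by omega) _ _ _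
      (hL.add hl) (hC r i (by omega) x _)))

/-- The factor W is kept inside the derivative, because the weights of earlier parts are
differentiated too. Integrability of the whole passes to each continuation for almost every sample,
so the recursion can be applied there. -/
theorem integral_grad_surrogateAux (hest : ∀ i, (est i).Smooth n θ₀)
    (hC : ∀ (r i : ℕ) (h : i + 1 + r = k) (x : P.Past i) (y : P.Block i),
      (P.condCost θ r (i + 1) h (P.snoc x y)).SmoothAt n θ₀) :
    ∀ (r i : ℕ) (h : i + r = k) (x : P.Past i) (W L : ADFun (G.Val θ) ℝ), W.SmoothAt n θ₀ →
      L.SmoothAt n θ₀ → (P.condCost θ r i h x).SmoothAt n θ₀ →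
      Integrable (fun T => ((W * P.surrogateAux est r i h x L T).grad n).forward θ₀)
        ((P.treeLawAux est θ₀ r i h).1 x) →
      ∫ T, ((W * P.surrogateAux est r i h x L T).grad n).forward θ₀
        ∂((P.treeLawAux est θ₀ r i h).1 x) = P.nestedMeanAux est n θ₀ r i h x W L
  | 0, i, h, x, W, L, _, _, _, _ => by
    have := (P.treeLawAux est θ₀ 0 i h).2
    simp only [surrogateAux, nestedMeanAux, integral_const, probReal_univ, one_smul, mul_assoc]
  | r + 1, i, h, x, W, L, hW, hL, hc, hint => by
    let e := est ⟨i, by omega⟩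
    let κ := P.treeLawAux est θ₀ r (i + 1) (by omega)
    have hκ : IsMarkovKernel κ.1 := κ.2
    have hq : IsMarkovKernel (e.q.forward θ₀) := e.q_prob θ₀
    have hi (X : P.Sample i) (j : Fin X.1) := hest ⟨i, by omega⟩ x X j
    let A (X : P.Sample i) (j : Fin X.1) := ((W * e.w x X j * L.magic * e.a x X j).grad n).forward θ₀
    let H (X : P.Sample i) (j : Fin X.1) (T : P.Tree r (i + 1)) :=
      ((W * e.w x X j * P.surrogateAux est r (i + 1) (by omega) (P.snoc x (X.2 j))
        (L + e.l x X j) T).grad n).forward θ₀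
    have hG (X : P.Sample i) (T : Fin X.1 → P.Tree r (i + 1)) :
        ((W * P.surrogateAux est (r + 1) i h x L
          (FinSample.mk X.1 fun j => (X.2 j, T j))).grad n).forward θ₀ =
          ∑ j, (A X j + H X j (T j)) := by
      have hsum : W * P.surrogateAux est (r + 1) i h x L
          (FinSample.mk X.1 fun j => (X.2 j, T j)) = ∑ j,
          (W * e.w x X j * L.magic * e.a x X j +
            W * e.w x X j * P.surrogateAux est r (i + 1) (by omega) (P.snoc x (X.2 j))
              (L + e.l x X j) (T j)) := by
        refine (Finset.mul_sum _ _ _).trans (Finset.sum_congr rfl fun j _ => ?_)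
        change W * (e.w x X j * (L.magic * e.a x X j + P.surrogateAux est r (i + 1) (by omega)
          (P.snoc x (X.2 j)) (L + e.l x X j) (T j))) = _
        ring
      have h1 (j : Fin X.1) := ((hW.mul (hi X j).1).mul hL.magic).mul (hi X j).2.2
      have h2 (j : Fin X.1) := (hW.mul (hi X j).1).mul
        (P.smoothAt_surrogateAux est hest hC r (i + 1) (by omega) _ _ (T j) (hL.add (hi X j).2.1)
          (hC r i (by omega) x (X.2 j)))
      rw [hsum, ADFun.grad_sum fun j _ => (h1 j).add (h2 j)]
      exact Finset.sum_congr rfl fun j _ => ADFun.grad_add (h1 j) (h2 j)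
    obtain ⟨hAH, hmean⟩ := integral_snd_compProd_branch (e.q.forward θ₀)
      (κ.1.comap _ (P.measurable_snoc i)) x _ (fun X j T => A X j + H X j T) hG hint
    refine hmean.trans (integral_congr_ae ?_)
    filter_upwards [hAH] with X hX
    refine Finset.sum_congr rfl fun j _ => ?_
    -- The control variate term is constant in the continuation T, so it can be subtracted.
    have hH : Integrable (H X j) (κ.1 (P.snoc x (X.2 j))) := by
      refine ((hX j).sub (integrable_const (A X j))).congr (Filter.Eventually.of_forall fun T => ?_)
      exact add_sub_cancel_left _ _
    rw [Kernel.comap_apply, integral_add (integrable_const _) hH, integral_const, probReal_univ,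
      one_smul]
    exact congrArg (A X j + ·) (integral_grad_surrogateAux hest hC r (i + 1) (by omega)
      (P.snoc x (X.2 j)) _ _ (hW.mul (hi X j).1) (hL.add (hi X j).2.1)
      (hC r i (by omega) x (X.2 j)) hH)

end TopPartition

end SCG

end

/-! ### The main theorem. -/

theorem theorem1 (G : SCG) (C : G.RealNode) (θ : G.Node) (hθ : θ ∈ G.params)
    [NormedAddCommGroup (G.Val θ)] [NormedSpace ℝ (G.Val θ)]
    {k : ℕ} (P : SCG.TopPartition C k)
    (est : ∀ i : Fin k, SCG.TopPartition.GradEstimator P θ i)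
    (n : ℕ) (θ₀ : G.Val θ)
    -- the graph is identical under evaluation
    (hG : G.IdenticalUnderEval)
    -- the expected cost is an absolutely convergent integral and is differentiable
    (hint : ∀ᶠ t in 𝓝 θ₀, Integrable (fun x => (C.integrand θ x).forward t)
      (SCG.refMeasure C.sources))
    (hdiff : ContDiffAt ℝ n (C.expect θ).forward θ₀)
    -- the components of the estimators are differentiable
    (hest : ∀ i, (est i).Smooth n θ₀)
    -- the deterministic functions for which the first condition is required: differentiable
    -- functions, among them the conditional expectations of the cost given the parts up to `i`
    (𝓕 : ∀ i : Fin k, P.Past i → Set (P.Block i → ADFun (G.Val θ) ℝ))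
    (h𝓕 : ∀ i x, ∀ f ∈ 𝓕 i x, ∀ y, (f y).SmoothAt n θ₀)
    (hC : ∀ (i : Fin k) (x : P.Past i),
      (fun y => P.condCost θ (k - (i + 1)) (i + 1) (by omega) (P.snoc x y)) ∈ 𝓕 i x)
    -- the four local conditions
    (h1 : ∀ i, (est i).UnbiasedSurrogate (𝓕 i) n θ₀)
    (h2 : ∀ i, (est i).ZeroMeanControl n θ₀)
    (h3 : ∀ i, (est i).ZeroMeanWeightGrad n θ₀)
    (h4 : ∀ i, (est i).ForwardInvariant) :
    -- the nested expectation of the evaluated derivative of the surrogate loss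
    P.nestedMean est n θ₀ = iteratedFDeriv ℝ n (C.expect θ).forward θ₀ ∧
    -- the expectation of the evaluated derivative of the surrogate loss, if it exists
    (Integrable (fun T => ((P.surrogate est T).grad n).forward θ₀) (P.treeLaw est θ₀) →
      ∫ T, ((P.surrogate est T).grad n).forward θ₀ ∂(P.treeLaw est θ₀) =
        iteratedFDeriv ℝ n (C.expect θ).forward θ₀) := by
  have hsmooth (i : Fin k) (x : P.Past i) (y : P.Block i) :
      (P.condCost θ (k - (i + 1)) (i + 1) (by omega) (P.snoc x y)).SmoothAt n θ₀ :=
    h𝓕 i x _ (hC i x) y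
  have hC' (r i : ℕ) (h : i + 1 + r = k) (x : P.Past i) (y : P.Block i) :
      (P.condCost θ r (i + 1) h (P.snoc x y)).SmoothAt n θ₀ := by
    obtain rfl : r = k - (i + 1) := by omega
    exact hsmooth ⟨i, by omega⟩ x y
  have h1' (r i : ℕ) (h : i + 1 + r = k) : (est ⟨i, by omega⟩).UnbiasedSurrogate
      (fun x => {fun y => P.condCost θ r (i + 1) h (P.snoc x y)}) n θ₀ := by
    obtain rfl : r = k - (i + 1) := by omega
    intro x f hf
    rw [Set.mem_singleton_iff.1 hf]
    exact h1 ⟨i, by omega⟩ x (fun y => P.condCost θ (k - (i + 1)) (i + 1) h (P.snoc x y))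
      (hC ⟨i, by omega⟩ x)
  -- Equality is needed near the point, with the frozen input held at `θ₀`, in order to compare
  -- derivatives; identity under evaluation moves the frozen input to t.
  have hexpect : (fun t => P.condCost θ k 0 (zero_add k) P.nil t θ₀) =ᶠ[𝓝 θ₀]
      (C.expect θ).forward := by
    filter_upwards [hint] with t ht
    rw [P.identicalUnderEval_condCost θ hG, ADFun.forward, P.condCost_nil θ t ht]
  -- The classes `𝓕` give smoothness only after at least one part has been fixed; at the top it
  -- comes from that of the expected cost.
  have hc : (P.condCost θ k 0 (zero_add k) P.nil).SmoothAt n θ₀ := hdiff.congr_of_eventuallyEq hexpect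
  have h0 : (0 : ADFun (G.Val θ) ℝ).SmoothAt n θ₀ := contDiffAt_const
  have h1c : (1 : ADFun (G.Val θ) ℝ).SmoothAt n θ₀ := contDiffAt_const
  have hmean : P.nestedMean est n θ₀ = iteratedFDeriv ℝ n (C.expect θ).forward θ₀ := by
    rw [SCG.TopPartition.nestedMean,
      P.nestedMeanAux_eq_grad est hest hC' h1' h2 k 0 _ _ _ _ h1c h0 hc, ADFun.magic_zero, one_mul,
      one_mul]
    exact (hexpect.iteratedFDeriv ℝ n).eq_of_nhds
  refine ⟨hmean, fun hI => ?_⟩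
  have hsur := P.integral_grad_surrogateAux est hest hC' k 0 (zero_add k) P.nil 1 0 h1c h0 hc
  simp only [one_mul] at hsur
  rw [← hmean]
  exact hsur hI
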